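/- Let $\alpha_i,\beta_i,\gamma_i$ ($i=0,1,2$) be complex numbers with $(\gamma_1,\gamma_2)\neq(0,0)$ such that $$f(x_1,x_2)=\left(\alpha_0+\alpha_1x_1+\alpha_2x_2,\ \frac{\beta_0+\beta_1x_1+\beta_2x_2}{\gamma_0+\gamma_1x_1+\gamma_2x_2}\right)$$ is a birational map of $\mathbb C^2$, and suppose that $\beta_1\gamma_2-\beta_2\gamma_1=0$ and $\gamma_2=0$. Let $F:\mathbb P^2\to\mathbb P^2$ be the extension of $f$ given by the embedding $(x_1,x_2)\mapsto[1:x_1:x_2]$. For $n\ge 0$ let $d_n$ be the degree of $F^n$, that is, the common degree of its homogeneous components after all common factors have been removed (so $d_0=1$), and let $\delta=\lim_{n\to\infty}d_n^{1/n}$. (a) If $\alpha_1\neq0$, then $d_{n+2}=d_{n+1}+d_n$ for all $n\ge 0$, and $\delta$ exists and equals $\frac{1+\sqrt5}{2}$. (b) If $\alpha_1=0$, then $\delta$ exists and equals $1$, and there are $b,c\in\mathbb C$ with $b\neq0$ such that $f$ is conjugate, by an affine change of coordinates of $\mathbb C^2$, to $$(x_1,x_2)\mapsto\left(x_2,\ \frac{b}{c+x_1}\right).$$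 Moreover, for all such $b,c$, put $h(z)=\frac{b}{c+z}$, regarded as a Möbius map of the Riemann sphere, and call $h$ $k$-periodic if $k$ is the least positive integer with $h^k=\mathrm{id}$. Then: - ($b_1$) if $h$ is not periodic, then $d_n=2$ for all $n\ge1$; - ($b_2$) if $h$ is $k$-periodic, then $(d_n)$ is $2k$-periodic: $d_{n+2k}=d_n$ for all $n\ge0$, and $2k$ is the least period, i.e. no positive integer $m<2k$ satisfies $d_{n+m}=d_n$ for all $n\ge1$. -/

import Mathlib

open Filter Topology

noncomputable section

/-- The affine function `c₀ + c₁ x₁ + c₂ x₂` on the plane, as a polynomial in the two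
coordinates `x₁ = X 0`, `x₂ = X 1`. -/
def affineForm (c : Fin 3 → ℂ) : MvPolynomial (Fin 2) ℂ :=
  MvPolynomial.C (c 0) + MvPolynomial.C (c 1) * MvPolynomial.X 0
    + MvPolynomial.C (c 2) * MvPolynomial.X 1

/-- The linear form `c₀ x₀ + c₁ x₁ + c₂ x₂` in the homogeneous coordinates of the projective
plane. -/
def linearForm (c : Fin 3 → ℂ) : MvPolynomial (Fin 3) ℂ :=
  MvPolynomial.C (c 0) * MvPolynomial.X 0 + MvPolynomial.C (c 1) * MvPolynomial.X 1
    + MvPolynomial.C (c 2) * MvPolynomial.X 2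

/-- A pair of fractions `num i / den i` of polynomials in two variables, describing a rational
map of `ℂ²` to itself (when the denominators are nonzero polynomials). -/
structure PlaneFrac where
  num : Fin 2 → MvPolynomial (Fin 2) ℂ
  den : Fin 2 → MvPolynomial (Fin 2) ℂ

namespace PlaneFrac

/-- Points where no denominator vanishes. -/
def Dom (f : PlaneFrac) (p : Fin 2 → ℂ) : Prop :=
  ∀ i, MvPolynomial.eval p (f.den i) ≠ 0

/-- The value at a point; meaningful on `Dom`. -/
def val (f : PlaneFrac) (p : Fin 2 → ℂ) : Fin 2 → ℂ :=
  fun i => MvPolynomial.eval p (f.num i) / MvPolynomial.eval p (f.den i)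

/-- `f` is birational: there are a rational map `g` and an algebraic curve `{V = 0}` outside of
which both compositions are defined and equal to the identity. -/
def IsBirational (f : PlaneFrac) : Prop :=
  ∃ (g : PlaneFrac) (V : MvPolynomial (Fin 2) ℂ), V ≠ 0 ∧
    ∀ p : Fin 2 → ℂ, MvPolynomial.eval p V ≠ 0 →
      (f.Dom p ∧ g.Dom (f.val p) ∧ g.val (f.val p) = p) ∧
      (g.Dom p ∧ f.Dom (g.val p) ∧ f.val (g.val p) = p)

/-- `f` is carried to `g` by an affine change of coordinates `ψ`, that is, `ψ ∘ f = g ∘ ψ` as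
rational maps (both sides are defined and equal outside some algebraic curve). -/
def AffinelyConjugate (f g : PlaneFrac) : Prop :=
  ∃ (ψ : (Fin 2 → ℂ) ≃ᵃ[ℂ] (Fin 2 → ℂ)) (V : MvPolynomial (Fin 2) ℂ), V ≠ 0 ∧
    ∀ p : Fin 2 → ℂ, MvPolynomial.eval p V ≠ 0 →
      f.Dom p ∧ g.Dom (ψ p) ∧ ψ (f.val p) = g.val (ψ p)

end PlaneFrac

/-- The map `(x₁, x₂) ↦ (α₀ + α₁ x₁ + α₂ x₂, (β₀ + β₁ x₁ + β₂ x₂) / (γ₀ + γ₁ x₁ + γ₂ x₂))`. -/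
def fracMap (α β γ : Fin 3 → ℂ) : PlaneFrac where
  num := ![affineForm α, affineForm β]
  den := ![1, affineForm γ]

/-- The extension of `fracMap α β γ` to the projective plane, in the chart
`(x₁, x₂) ↦ [1 : x₁ : x₂]`. -/
def projMap (α β γ : Fin 3 → ℂ) : Fin 3 → MvPolynomial (Fin 3) ℂ :=
  ![MvPolynomial.X 0 * linearForm γ, linearForm α * linearForm γ,
    MvPolynomial.X 0 * linearForm β]

/-- The `n`-fold composition `F ∘ ⋯ ∘ F` of a triple of polynomials, before any common factor of
the components is removed. -/
def iterTriple (F : Fin 3 → MvPolynomial (Fin 3) ℂ) : ℕ → Fin 3 → MvPolynomial (Fin 3) ℂ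
  | 0 => MvPolynomial.X
  | n + 1 => fun i => MvPolynomial.bind₁ (iterTriple F n) (F i)

/-- The degree of the rational self-map of the projective plane given by a nonzero triple `P` of
homogeneous polynomials of the same degree: the degree of the components that is left once a
common factor `G`, of the largest possible degree, has been removed. -/
def mapDegree (P : Fin 3 → MvPolynomial (Fin 3) ℂ) : ℕ :=
  sInf {d : ℕ | ∃ (G : MvPolynomial (Fin 3) ℂ) (Q : Fin 3 → MvPolynomial (Fin 3) ℂ),
    (∀ i, P i = G * Q i) ∧ ∀ i, (Q i).IsHomogeneous d}

/-- The degree `d_n` of the `n`-th iterate of the extension of `fracMap α β γ` to the projective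
plane. -/
def iterDegree (α β γ : Fin 3 → ℂ) (n : ℕ) : ℕ :=
  mapDegree (iterTriple (projMap α β γ) n)

/-- The limit of `d_n ^ (1 / n)` exists and equals `δ`. -/
def HasDynamicalDegree (α β γ : Fin 3 → ℂ) (δ : ℝ) : Prop :=
  Tendsto (fun n : ℕ => (iterDegree α β γ n : ℝ) ^ (1 / (n : ℝ))) atTop (𝓝 δ)

open Classical in
/-- The one-dimensional map `h(z) = b / (c + z)`, with `b ≠ 0`, on the Riemann sphere. -/
def moebius (b c : ℂ) : OnePoint ℂ → OnePoint ℂ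
  | OnePoint.infty => OnePoint.some 0
  | OnePoint.some z => if c + z = 0 then OnePoint.infty else OnePoint.some (b / (c + z))

/-- `h` is periodic of (least) period `k`. -/
def IsPeriodicMap {S : Type*} (h : S → S) (k : ℕ) : Prop :=
  IsLeast {m : ℕ | 0 < m ∧ h^[m] = id} k

end

/-! Birationality with `β 2 = γ 2 = 0` forces `α 2 ≠ 0` and `β 0 * γ 1 - β 1 * γ 0 ≠ 0`. The second
coordinate of `f` depends on `x₁` alone, so the first coordinates `xₙ` of an orbit satisfy a scalar
recurrence `xₙ₊₂ = α₀ + α₁ xₙ₊₁ + α₂ (β₀ + β₁ xₙ) / (γ₀ + γ₁ xₙ)`, and degrees are read off from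
fractions `pₙ / qₙ` for `xₙ`. By `mapDegree_eq_of_projEq`, any proportional triple of forms without
a common prime gives the degree.

If `α 1 ≠ 0`, the recurrence never produces a cancellation (`orbitFrac_coprime`). So `pₙ, qₙ` have
Fibonacci degrees, `dₙ = fib (n + 2)`, and the golden ratio is the growth rate.

If `α 1 = 0`, the recurrence splits: `xₙ₊₂ = R(xₙ)` for one Möbius map `R`, with matrix
`returnMatrix`. Every iterate is then a triple of quadratic forms, which share a factor exactly when
`n` is even and `R^(n/2) = id`; what remains is then the identity or linear data of degree 1. Any
affine conjugacy to `(x₂, b / (c + x₁))` restricts to an affine conjugacy from `R` to `h`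
(`returnMatrix_intertwine`), so the periods of `h` decide where the degree drops. -/

/-! ### Degree of a rational map from a reduced representative. -/

section MapDegree

open MvPolynomial

/-- No prime divides all members of the family. -/
def NoCommonPrime {R ι : Type*} [CommRing R] (Q : ι → R) : Prop :=
  ∀ g : R, Prime g → ∃ i, ¬ g ∣ Q i

/-- Each prime factor of `a` misses some `Q i`, hence divides `b`; cancel it and continue by
induction on the factorization of `a`. -/
theorem NoCommonPrime.dvd_of_dvd_mul {R ι : Type*} [CommRing R] [IsDomain R]
    [UniqueFactorizationMonoid R] {Q : ι → R} (hQ : NoCommonPrime Q) (a : R) (ha : a ≠ 0) :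
    ∀ b : R, (∀ i, a ∣ b * Q i) → a ∣ b := by
  induction a using UniqueFactorizationMonoid.induction_on_prime with
  | h₁ => exact absurd rfl ha
  | h₂ x hx => exact fun b _ => hx.dvd
  | h₃ a p ha0 hp ih =>
    intro b hb
    obtain ⟨i, hi⟩ := hQ p hp
    obtain ⟨b', rfl⟩ := (hp.dvd_or_dvd ((dvd_mul_right p a).trans (hb i))).resolve_right hi
    refine mul_dvd_mul_left p (ih ha0 b' fun j => ?_)
    have := hb j
    rw [mul_assoc] at this
    exact (mul_dvd_mul_iff_left hp.ne_zero).1 this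

/-- Two families of polynomials that are proportional to each other by nonzero polynomials. -/
def ProjEq {R ι : Type*} [CommRing R] (P Q : ι → R) : Prop :=
  ∃ A B : R, A ≠ 0 ∧ B ≠ 0 ∧ ∀ i, A * P i = B * Q i

theorem ProjEq.refl {R ι : Type*} [CommRing R] [Nontrivial R] (P : ι → R) : ProjEq P P :=
  ⟨1, 1, one_ne_zero, one_ne_zero, fun _ => rfl⟩

theorem ProjEq.trans {R ι : Type*} [CommRing R] [IsDomain R] {P Q S : ι → R}
    (h : ProjEq P Q) (h' : ProjEq Q S) : ProjEq P S := by
  obtain ⟨A, B, hA, hB, h⟩ := h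
  obtain ⟨A', B', hA', hB', h'⟩ := h'
  refine ⟨A' * A, B * B', mul_ne_zero hA' hA, mul_ne_zero hB hB', fun i => ?_⟩
  rw [mul_assoc, h i, mul_left_comm, h' i, mul_assoc]

/-- Absence of common primes forces `P = G * Q`, and likewise forces any other extracted factor `G'`
to divide `G`. The corresponding quotient is then a multiple of `Q`, so its degree is at least `D`.
-/
theorem mapDegree_eq_of_projEq {P Q : Fin 3 → MvPolynomial (Fin 3) ℂ} {D : ℕ}
    (h : ProjEq P Q) (hQ : NoCommonPrime Q) (hD : ∀ i, (Q i).IsHomogeneous D) :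
    mapDegree P = D := by
  obtain ⟨A, B, hA, hB, h⟩ := h
  obtain ⟨i₀, hi₀⟩ := hQ (X 0) X_prime
  have hQ0 : Q i₀ ≠ 0 := fun h => hi₀ (h ▸ dvd_zero _)
  obtain ⟨G, rfl⟩ := hQ.dvd_of_dvd_mul A hA B fun i => ⟨P i, (h i).symm⟩
  have hG : G ≠ 0 := right_ne_zero_of_mul hB
  have hP : ∀ i, P i = G * Q i := fun i =>
    mul_left_cancel₀ hA (by rw [h i, mul_assoc])
  refine le_antisymm (Nat.sInf_le ⟨G, Q, hP, hD⟩) (le_csInf ⟨D, G, Q, hP, hD⟩ ?_)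
  rintro d ⟨G', Q', hP', hd⟩
  have hG' : G' ≠ 0 := by
    rintro rfl
    have := hP i₀
    rw [hP' i₀, zero_mul] at this
    exact mul_ne_zero hG hQ0 this.symm
  obtain ⟨H, rfl⟩ := hQ.dvd_of_dvd_mul G' hG' G fun i => ⟨Q' i, by rw [← hP, hP']⟩
  have hH : H ≠ 0 := right_ne_zero_of_mul hG
  have hQ' : Q' i₀ = H * Q i₀ :=
    mul_left_cancel₀ hG' (by rw [← hP', hP, mul_assoc])
  have h1 := (hd i₀).totalDegree (hQ' ▸ mul_ne_zero hH hQ0)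
  rw [hQ', totalDegree_mul_of_isDomain hH hQ0, (hD i₀).totalDegree hQ0] at h1
  omega

theorem eval_linearForm (c x : Fin 3 → ℂ) :
    eval x (linearForm c) = c 0 * x 0 + c 1 * x 1 + c 2 * x 2 := by
  simp [linearForm]

theorem isHomogeneous_linearForm (c : Fin 3 → ℂ) : (linearForm c).IsHomogeneous 1 := by
  have h : ∀ i, (C (c i) * X i : MvPolynomial (Fin 3) ℂ).IsHomogeneous 1 := fun i => by
    simpa using (isHomogeneous_C (Fin 3) (c i)).mul (isHomogeneous_X ℂ i)
  exact ((h 0).add (h 1)).add (h 2)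

/-- A prime does not divide two linear forms that are not proportional. -/
theorem not_dvd_linearForm {g : MvPolynomial (Fin 3) ℂ} (hg : Prime g) {c c' : Fin 3 → ℂ}
    (x : Fin 3 → ℂ) (hc : linearForm c ≠ 0) (hx : eval x (linearForm c) = 0)
    (hx' : eval x (linearForm c') ≠ 0) (h : g ∣ linearForm c) : ¬ g ∣ linearForm c' := by
  rintro ⟨b, hb⟩
  obtain ⟨a, ha⟩ := h
  have ha0 : a ≠ 0 := by rintro rfl; exact hc (by rw [ha, mul_zero])
  have hdeg := (isHomogeneous_linearForm c).totalDegree hc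
  rw [ha, totalDegree_mul_of_isDomain hg.ne_zero ha0] at hdeg
  by_cases hg0 : g.totalDegree = 0
  · rw [totalDegree_eq_zero_iff_eq_C] at hg0
    refine hg.not_isUnit ?_
    rw [hg0]
    refine IsUnit.map C (isUnit_iff_ne_zero.2 fun h0 => hg.ne_zero ?_)
    rw [hg0, h0, map_zero]
  · have ha1 : a.totalDegree = 0 := by omega
    rw [totalDegree_eq_zero_iff_eq_C] at ha1
    have he : coeff 0 a ≠ 0 := fun h0 => ha0 (by rw [ha1, h0, map_zero])
    rw [ha, ha1, map_mul, eval_C] at hx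
    refine hx' ?_
    rw [hb, map_mul, (mul_eq_zero.1 hx).resolve_right he, zero_mul]

theorem linearForm_ne_zero {c x : Fin 3 → ℂ} (h : eval x (linearForm c) ≠ 0) :
    linearForm c ≠ 0 := fun h0 => h (by rw [h0, map_zero])

theorem X_eq_linearForm (i : Fin 3) :
    (X i : MvPolynomial (Fin 3) ℂ) = linearForm (Pi.single i 1) := by
  fin_cases i <;> simp [linearForm]

theorem noCommonPrime_X : NoCommonPrime (X : Fin 3 → MvPolynomial (Fin 3) ℂ) := by
  intro g hg
  by_contra! h
  have h0 := h 0
  have h1 := h 1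
  rw [X_eq_linearForm] at h0 h1
  refine not_dvd_linearForm hg ![0, 1, 0] ?_ ?_ ?_ h0 h1
  · exact linearForm_ne_zero (x := ![1, 0, 0]) (by simp [eval_linearForm])
  · simp [eval_linearForm]
  · simp [eval_linearForm]

theorem iterTriple_projMap_succ (α β γ : Fin 3 → ℂ) (n : ℕ) :
    let P := iterTriple (projMap α β γ) n
    let A := C (α 0) * P 0 + C (α 1) * P 1 + C (α 2) * P 2
    let B := C (β 0) * P 0 + C (β 1) * P 1 + C (β 2) * P 2
    let L := C (γ 0) * P 0 + C (γ 1) * P 1 + C (γ 2) * P 2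
    iterTriple (projMap α β γ) (n + 1) = ![P 0 * L, A * L, P 0 * B] := by
  funext i
  fin_cases i <;> simp [iterTriple, projMap, linearForm]

/-- If `F ^ n` is represented by `Q`, and `F ∘ Q` by `Q'`, then `F ^ (n + 1)` is represented
by `Q'`. -/
theorem ProjEq.iterTriple_succ {α β γ : Fin 3 → ℂ} {n : ℕ}
    {Q Q' : Fin 3 → MvPolynomial (Fin 3) ℂ} (h : ProjEq (iterTriple (projMap α β γ) n) Q)
    (h' : ProjEq ![Q 0 * (C (γ 0) * Q 0 + C (γ 1) * Q 1 + C (γ 2) * Q 2),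
      (C (α 0) * Q 0 + C (α 1) * Q 1 + C (α 2) * Q 2) *
        (C (γ 0) * Q 0 + C (γ 1) * Q 1 + C (γ 2) * Q 2),
      Q 0 * (C (β 0) * Q 0 + C (β 1) * Q 1 + C (β 2) * Q 2)] Q') :
    ProjEq (iterTriple (projMap α β γ) (n + 1)) Q' := by
  refine ProjEq.trans ?_ h'
  obtain ⟨A, B, hA, hB, h⟩ := h
  refine ⟨A * A, B * B, mul_ne_zero hA hA, mul_ne_zero hB hB, fun i => ?_⟩
  rw [iterTriple_projMap_succ]
  generalize iterTriple (projMap α β γ) n = P at h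
  have e : ∀ c : Fin 3 → ℂ, A * (C (c 0) * P 0 + C (c 1) * P 1 + C (c 2) * P 2) =
      B * (C (c 0) * Q 0 + C (c 1) * Q 1 + C (c 2) * Q 2) := fun c => by
    linear_combination C (c 0) * h 0 + C (c 1) * h 1 + C (c 2) * h 2
  fin_cases i
  · simpa using by rw [mul_mul_mul_comm, h 0, e γ, mul_mul_mul_comm]
  · simpa using by rw [mul_mul_mul_comm, e α, e γ, mul_mul_mul_comm]
  · simpa using by rw [mul_mul_mul_comm, h 0, e β, mul_mul_mul_comm]

theorem iterDegree_zero (α β γ : Fin 3 → ℂ) : iterDegree α β γ 0 = 1 :=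
  mapDegree_eq_of_projEq (ProjEq.refl _) noCommonPrime_X fun i => isHomogeneous_X ℂ i

end MapDegree

/-! ### The case `α 1 ≠ 0`: Fibonacci degrees. -/

section Fibonacci

open MvPolynomial

variable (α β γ : Fin 3 → ℂ)

/-- Numerator and denominator of the first coordinate of the iterates of `fracMap α β γ`, when
`β 2 = γ 2 = 0`. -/
noncomputable def orbitFrac : ℕ → MvPolynomial (Fin 3) ℂ × MvPolynomial (Fin 3) ℂ
  | 0 => (X 1, X 0)
  | 1 => (linearForm α, X 0)
  | n + 2 =>
    ((C (α 0) * (orbitFrac (n + 1)).2 + C (α 1) * (orbitFrac (n + 1)).1) *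
        (C (γ 0) * (orbitFrac n).2 + C (γ 1) * (orbitFrac n).1) +
      C (α 2) * (orbitFrac (n + 1)).2 *
        (C (β 0) * (orbitFrac n).2 + C (β 1) * (orbitFrac n).1),
     (orbitFrac (n + 1)).2 * (C (γ 0) * (orbitFrac n).2 + C (γ 1) * (orbitFrac n).1))

/-- The form `c₀ q + c₁ p` at the `n`-th fraction `p / q`. -/
noncomputable def orbitForm (c : Fin 3 → ℂ) (n : ℕ) : MvPolynomial (Fin 3) ℂ :=
  C (c 0) * (orbitFrac α β γ n).2 + C (c 1) * (orbitFrac α β γ n).1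

variable {α β γ}

theorem orbitFrac_den_succ_succ (n : ℕ) : (orbitFrac α β γ (n + 2)).2 =
    (orbitFrac α β γ (n + 1)).2 * orbitForm α β γ γ n := rfl

theorem orbitFrac_num_succ_succ (n : ℕ) : (orbitFrac α β γ (n + 2)).1 =
    orbitForm α β γ α (n + 1) * orbitForm α β γ γ n +
      C (α 2) * (orbitFrac α β γ (n + 1)).2 * orbitForm α β γ β n := rfl

theorem isHomogeneous_C_mul {p : MvPolynomial (Fin 3) ℂ} {d : ℕ} (h : p.IsHomogeneous d) (c : ℂ) :
    (C c * p).IsHomogeneous d := by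
  simpa using (isHomogeneous_C (Fin 3) c).mul h

theorem orbitForm_isHomogeneous {n d : ℕ} (h1 : (orbitFrac α β γ n).1.IsHomogeneous d)
    (h2 : (orbitFrac α β γ n).2.IsHomogeneous d) (c : Fin 3 → ℂ) :
    (orbitForm α β γ c n).IsHomogeneous d :=
  (isHomogeneous_C_mul h2 _).add (isHomogeneous_C_mul h1 _)

theorem orbitFrac_isHomogeneous (n : ℕ) :
    ((orbitFrac α β γ n).1.IsHomogeneous (Nat.fib (n + 1)) ∧
      (orbitFrac α β γ n).2.IsHomogeneous (Nat.fib (n + 1))) ∧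
    ((orbitFrac α β γ (n + 1)).1.IsHomogeneous (Nat.fib (n + 2)) ∧
      (orbitFrac α β γ (n + 1)).2.IsHomogeneous (Nat.fib (n + 2))) := by
  induction n with
  | zero => exact ⟨⟨isHomogeneous_X ℂ _, isHomogeneous_X ℂ _⟩, isHomogeneous_linearForm _,
      isHomogeneous_X ℂ _⟩
  | succ n ih =>
    have hd : Nat.fib (n + 1 + 2) = Nat.fib (n + 2) + Nat.fib (n + 1) :=
      Nat.fib_add_two.trans (add_comm _ _)
    have hL := fun c => orbitForm_isHomogeneous ih.1.1 ih.1.2 c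
    have hL' := fun c => orbitForm_isHomogeneous ih.2.1 ih.2.2 c
    refine ⟨ih.2, ?_, ?_⟩
    · rw [orbitFrac_num_succ_succ, hd]
      exact ((hL' α).mul (hL γ)).add ((isHomogeneous_C_mul ih.2.2 _).mul (hL β))
    · rw [orbitFrac_den_succ_succ, hd]
      exact ih.2.2.mul (hL γ)

theorem orbitFrac_den_dvd (n : ℕ) : (orbitFrac α β γ n).2 ∣ (orbitFrac α β γ (n + 1)).2 := by
  cases n with
  | zero => exact dvd_rfl
  | succ n => exact dvd_mul_right _ _

theorem X_dvd_orbitFrac_den (n : ℕ) : X 0 ∣ (orbitFrac α β γ n).2 := by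
  induction n with
  | zero => exact dvd_rfl
  | succ n ih => exact ih.trans (orbitFrac_den_dvd n)

theorem dvd_of_dvd_C_mul {g p : MvPolynomial (Fin 3) ℂ} {c : ℂ} (hc : c ≠ 0)
    (h : g ∣ C c * p) : g ∣ p := by
  have : p = C c⁻¹ * (C c * p) := by rw [← mul_assoc, ← C_mul, inv_mul_cancel₀ hc, C_1, one_mul]
  rw [this]
  exact h.mul_left _

/-- The first coordinates of two successive iterates are not both constant along a curve that is
not contained in the polar locus. -/
theorem orbitFrac_not_const (hα2 : α 2 ≠ 0) (hdet : β 0 * γ 1 - β 1 * γ 0 ≠ 0)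
    {g : MvPolynomial (Fin 3) ℂ} (hg : Prime g) (n : ℕ) :
    ∀ c c' : ℂ, ¬ g ∣ (orbitFrac α β γ (n + 1)).2 →
      g ∣ (orbitFrac α β γ n).1 - C c * (orbitFrac α β γ n).2 →
      ¬ g ∣ (orbitFrac α β γ (n + 1)).1 - C c' * (orbitFrac α β γ (n + 1)).2 := by
  induction n with
  | zero =>
    intro c c' _ h0 h1
    have e0 : (orbitFrac α β γ 0).1 - C c * (orbitFrac α β γ 0).2 = linearForm ![-c, 1, 0] := by
      simp [orbitFrac, linearForm]; ring
    have e1 : (orbitFrac α β γ 1).1 - C c' * (orbitFrac α β γ 1).2 =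
        linearForm ![α 0 - c', α 1, α 2] := by
      simp [orbitFrac, linearForm]; ring
    rw [e0] at h0
    rw [zero_add, e1] at h1
    -- A point of the line `x₁ = c x₀` whose last coordinate is chosen so that the second form takes
    -- the value 1.
    refine not_dvd_linearForm hg ![1, c, (1 - (α 0 - c') - α 1 * c) / α 2] ?_ ?_ ?_ h0 h1
    · exact linearForm_ne_zero (x := ![0, 1, 0]) (by simp [eval_linearForm])
    · simp [eval_linearForm]
    · simp [eval_linearForm, mul_div_cancel₀ _ hα2]
  | succ n ih =>
    intro c c' hq h1 h2
    rw [orbitFrac_den_succ_succ] at hq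
    have hq1 : ¬ g ∣ (orbitFrac α β γ (n + 1)).2 := fun h => hq (h.mul_right _)
    have hq0 : ¬ g ∣ (orbitFrac α β γ n).2 := fun h => hq1 (h.trans (orbitFrac_den_dvd n))
    set e : ℂ := α 0 + α 1 * c - c' with he
    -- Modulo `g`, replacing the numerator at `n + 1` by `c` times the denominator makes that
    -- denominator a factor of the difference in `h2`; the cofactor is a linear relation between the
    -- numerator and denominator at `n`.
    have key : g ∣ C (e * γ 0 + α 2 * β 0) * (orbitFrac α β γ n).2 +
        C (e * γ 1 + α 2 * β 1) * (orbitFrac α β γ n).1 := by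
      refine (hg.dvd_or_dvd (b := _) (a := (orbitFrac α β γ (n + 1)).2) ?_).resolve_left hq1
      have := dvd_sub h2 (h1.mul_right (C (α 1) * orbitForm α β γ γ n))
      convert this using 1
      rw [orbitFrac_den_succ_succ, orbitFrac_num_succ_succ]
      simp only [orbitForm, he, C_add, C_sub, C_mul]
      ring
    -- Either the relation is trivial, against `hdet`, or it makes the fraction at `n` constant
    -- along `g`, and the induction hypothesis applies one step earlier.
    by_cases hw : e * γ 1 + α 2 * β 1 = 0
    · rw [hw, C_0, zero_mul, add_zero] at key
      have hw0 : e * γ 0 + α 2 * β 0 = 0 := by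
        by_contra h
        exact hq0 (dvd_of_dvd_C_mul h key)
      have : α 2 * (β 0 * γ 1 - β 1 * γ 0) = 0 := by
        linear_combination γ 1 * hw0 - γ 0 * hw
      exact mul_ne_zero hα2 hdet this
    · refine ih (-(e * γ 0 + α 2 * β 0) / (e * γ 1 + α 2 * β 1)) c hq1 ?_ h1
      refine dvd_of_dvd_C_mul hw ?_
      convert key using 1
      rw [mul_sub, ← mul_assoc, ← C_mul, mul_div_cancel₀ _ hw, C_neg]
      ring

theorem orbitForm_dvd_num {g : MvPolynomial (Fin 3) ℂ} {c : Fin 3 → ℂ} {n : ℕ} (hc : c 1 ≠ 0)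
    (h : g ∣ orbitForm α β γ c n) :
    g ∣ (orbitFrac α β γ n).1 - C (-(c 0 / c 1)) * (orbitFrac α β γ n).2 := by
  refine dvd_of_dvd_C_mul hc ?_
  convert h using 1
  rw [mul_sub, ← mul_assoc, ← C_mul, mul_neg, mul_div_cancel₀ _ hc, C_neg, orbitForm]
  ring

theorem dvd_num_and_den_of_dvd_orbitForm (hdet : β 0 * γ 1 - β 1 * γ 0 ≠ 0)
    {g : MvPolynomial (Fin 3) ℂ} {n : ℕ} (hβ : g ∣ orbitForm α β γ β n)
    (hγ : g ∣ orbitForm α β γ γ n) : g ∣ (orbitFrac α β γ n).1 ∧ g ∣ (orbitFrac α β γ n).2 := by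
  constructor <;> refine dvd_of_dvd_C_mul hdet ?_
  · convert dvd_sub (hγ.mul_left (C (β 0))) (hβ.mul_left (C (γ 0))) using 1
    simp only [orbitForm, C_sub, C_mul]; ring
  · convert dvd_sub (hβ.mul_left (C (γ 1))) (hγ.mul_left (C (β 1))) using 1
    simp only [orbitForm, C_sub, C_mul]; ring

/-- The claims support each other in one induction. A prime common to two successive `γ`-forms would
put two successive first coordinates at the pole `-γ 0 / γ 1`, which `orbitFrac_not_const` excludes;
`α 1 ≠ 0` stops primes of the old denominator from entering the new numerator. -/
theorem orbitFrac_coprime (hα1 : α 1 ≠ 0) (hα2 : α 2 ≠ 0) (hγ1 : γ 1 ≠ 0)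
    (hdet : β 0 * γ 1 - β 1 * γ 0 ≠ 0) {g : MvPolynomial (Fin 3) ℂ} (hg : Prime g) (n : ℕ) :
    (¬ (g ∣ (orbitFrac α β γ n).1 ∧ g ∣ (orbitFrac α β γ n).2)) ∧
    (¬ (g ∣ (orbitFrac α β γ (n + 1)).1 ∧ g ∣ (orbitFrac α β γ (n + 1)).2)) ∧
    ¬ (g ∣ orbitForm α β γ γ n ∧ g ∣ (orbitFrac α β γ (n + 1)).2) := by
  induction n with
  | zero =>
    have key : ∀ c : Fin 3 → ℂ, c 1 ≠ 0 → g ∣ linearForm c → ¬ g ∣ X 0 := by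
      intro c hc h h0
      rw [X_eq_linearForm] at h0
      refine not_dvd_linearForm hg ![0, 1, 0] ?_ ?_ ?_ h0 h
      · exact linearForm_ne_zero (x := ![1, 0, 0]) (by simp [eval_linearForm])
      · simp [eval_linearForm]
      · simpa [eval_linearForm] using hc
    refine ⟨fun h => key (Pi.single 1 1) (by simp) ?_ h.2, fun h => key α hα1 h.1 h.2,
      fun h => key ![γ 0, γ 1, 0] (by simpa using hγ1) ?_ h.2⟩
    · rw [← X_eq_linearForm]; exact h.1
    · simpa [orbitForm, orbitFrac, linearForm] using h.1
  | succ n ih =>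
    obtain ⟨h0, h1, hs⟩ := ih
    refine ⟨h1, ?_, ?_⟩
    · rintro ⟨hp, hq⟩
      rw [orbitFrac_den_succ_succ] at hq
      rw [orbitFrac_num_succ_succ] at hp
      rcases hg.dvd_or_dvd hq with hq | hL
      · have h := (dvd_add_left ((hq.mul_left (C (α 2))).mul_right _)).1 hp
        rcases hg.dvd_or_dvd h with h | h
        · refine h1 ⟨dvd_of_dvd_C_mul hα1 ?_, hq⟩
          exact (dvd_add_right (hq.mul_left _)).1 h
        · exact hs ⟨h, hq⟩
      · have h := (dvd_add_right (hL.mul_left _)).1 hp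
        rcases hg.dvd_or_dvd h with h | h
        · exact hs ⟨hL, dvd_of_dvd_C_mul hα2 h⟩
        · exact h0 (dvd_num_and_den_of_dvd_orbitForm hdet h hL)
    · rintro ⟨hL', hq⟩
      rw [orbitFrac_den_succ_succ] at hq
      rcases hg.dvd_or_dvd hq with hq | hL
      · exact h1 ⟨dvd_of_dvd_C_mul hγ1 ((dvd_add_right (hq.mul_left _)).1 hL'), hq⟩
      · exact orbitFrac_not_const hα2 hdet hg n _ _ (fun h => hs ⟨hL, h⟩)
          (orbitForm_dvd_num hγ1 hL) (orbitForm_dvd_num hγ1 hL')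

theorem orbitForm_ne_zero (hα1 : α 1 ≠ 0) (hα2 : α 2 ≠ 0) (hγ1 : γ 1 ≠ 0)
    (hdet : β 0 * γ 1 - β 1 * γ 0 ≠ 0) (n : ℕ) : orbitForm α β γ γ n ≠ 0 := fun h =>
  (orbitFrac_coprime hα1 hα2 hγ1 hdet X_prime n).2.2
    ⟨h ▸ dvd_zero _, X_dvd_orbitFrac_den (n + 1)⟩

theorem projEq_orbitFrac (hα1 : α 1 ≠ 0) (hα2 : α 2 ≠ 0) (hγ1 : γ 1 ≠ 0)
    (hdet : β 0 * γ 1 - β 1 * γ 0 ≠ 0) (hβ2 : β 2 = 0) (hγ2 : γ 2 = 0) (n : ℕ) :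
    ProjEq (iterTriple (projMap α β γ) (n + 1))
      ![(orbitFrac α β γ (n + 1)).2 * orbitForm α β γ γ n,
        (orbitFrac α β γ (n + 1)).1 * orbitForm α β γ γ n,
        orbitForm α β γ β n * (orbitFrac α β γ (n + 1)).2] := by
  induction n with
  | zero =>
    refine (ProjEq.refl _).iterTriple_succ ⟨1, 1, one_ne_zero, one_ne_zero, fun i => ?_⟩
    fin_cases i <;>
      simp [iterTriple, orbitForm, orbitFrac, hβ2, hγ2, linearForm, mul_comm]
  | succ n ih =>
    -- Composing with the map creates exactly the removable factor `orbitForm α β γ γ n`.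
    refine ih.iterTriple_succ ⟨1, orbitForm α β γ γ n, one_ne_zero,
      orbitForm_ne_zero hα1 hα2 hγ1 hdet n, fun i => ?_⟩
    rw [orbitFrac_den_succ_succ, orbitFrac_num_succ_succ]
    fin_cases i <;> simp [orbitForm, hβ2, hγ2] <;> ring

theorem iterDegree_eq_fib (hα1 : α 1 ≠ 0) (hα2 : α 2 ≠ 0) (hγ1 : γ 1 ≠ 0)
    (hdet : β 0 * γ 1 - β 1 * γ 0 ≠ 0) (hβ2 : β 2 = 0) (hγ2 : γ 2 = 0) (n : ℕ) :
    iterDegree α β γ n = Nat.fib (n + 2) := by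
  cases n with
  | zero => rw [iterDegree_zero]; rfl
  | succ n =>
    refine mapDegree_eq_of_projEq (projEq_orbitFrac hα1 hα2 hγ1 hdet hβ2 hγ2 n) ?_ ?_
    · intro g hg
      by_contra! h
      have h0 : g ∣ (orbitFrac α β γ (n + 1)).2 * orbitForm α β γ γ n := h 0
      have h1 : g ∣ (orbitFrac α β γ (n + 1)).1 * orbitForm α β γ γ n := h 1
      have h2 : g ∣ orbitForm α β γ β n * (orbitFrac α β γ (n + 1)).2 := h 2
      obtain ⟨k0, k1, ks⟩ := orbitFrac_coprime (α := α) hα1 hα2 hγ1 hdet hg n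
      by_cases hL : g ∣ orbitForm α β γ γ n
      · rcases hg.dvd_or_dvd h2 with h | h
        · exact k0 (dvd_num_and_den_of_dvd_orbitForm hdet h hL)
        · exact ks ⟨hL, h⟩
      · exact k1 ⟨(hg.dvd_or_dvd h1).resolve_right hL, (hg.dvd_or_dvd h0).resolve_right hL⟩
    · have hh := orbitFrac_isHomogeneous (α := α) (β := β) (γ := γ) n
      have hL := fun c => orbitForm_isHomogeneous hh.1.1 hh.1.2 c
      have hd : Nat.fib (n + 1 + 2) = Nat.fib (n + 2) + Nat.fib (n + 1) :=
      Nat.fib_add_two.trans (add_comm _ _)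
      intro i
      rw [hd]
      fin_cases i
      · exact hh.2.2.mul (hL γ)
      · exact hh.2.1.mul (hL γ)
      · rw [add_comm (Nat.fib _)]; exact (hL β).mul hh.2.2

end Fibonacci

/-! ### Growth rates of sequences and of Fibonacci numbers. -/

section Growth

open Real

theorem tendsto_const_rpow_one_div {c : ℝ} (hc : 0 < c) :
    Tendsto (fun n : ℕ => c ^ (1 / (n : ℝ))) atTop (𝓝 1) := by
  have := (tendsto_const_nhds (x := c)).rpow tendsto_one_div_atTop_nhds_zero_nat
    (Or.inl hc.ne')
  simpa using this

theorem tendsto_rpow_one_div_of_bounds {d : ℕ → ℝ} {φ c : ℝ} (hφ : 0 < φ) (hc : 0 < c)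
    (h1 : ∀ n, φ ^ n ≤ d n) (h2 : ∀ n, d n ≤ c * φ ^ n) :
    Tendsto (fun n : ℕ => d n ^ (1 / (n : ℝ))) atTop (𝓝 φ) := by
  have hroot : ∀ n : ℕ, n ≠ 0 → (φ ^ n) ^ (1 / (n : ℝ)) = φ := fun n hn => by
    rw [one_div, Real.pow_rpow_inv_natCast hφ.le hn]
  refine tendsto_of_tendsto_of_tendsto_of_le_of_le' (tendsto_const_nhds (x := φ))
    (h := fun n : ℕ => c ^ (1 / (n : ℝ)) * φ) ?_ ?_ ?_
  · simpa using (tendsto_const_rpow_one_div hc).mul_const φ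
  · filter_upwards [eventually_ne_atTop 0] with n hn
    have := Real.rpow_le_rpow (by positivity) (h1 n) (by positivity : 0 ≤ 1 / (n : ℝ))
    rwa [hroot n hn] at this
  · filter_upwards [eventually_ne_atTop 0] with n hn
    have := Real.rpow_le_rpow ((pow_nonneg hφ.le n).trans (h1 n)) (h2 n)
      (by positivity : 0 ≤ 1 / (n : ℝ))
    rwa [Real.mul_rpow hc.le (by positivity), hroot n hn] at this

/-- All terms satisfy the Fibonacci recursion, so two consecutive base cases suffice. -/
theorem goldenRatio_pow_le_fib (n : ℕ) :
    (goldenRatio ^ n ≤ Nat.fib (n + 2) ∧ (Nat.fib (n + 2) : ℝ) ≤ goldenRatio * goldenRatio ^ n) ∧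
    (goldenRatio ^ (n + 1) ≤ Nat.fib (n + 3) ∧
      (Nat.fib (n + 3) : ℝ) ≤ goldenRatio * goldenRatio ^ (n + 1)) := by
  have h1 := one_lt_goldenRatio
  have h2 := goldenRatio_lt_two
  have hsq := goldenRatio_sq
  induction n with
  | zero =>
    norm_num [Nat.fib_add_two]
    refine ⟨h1.le, h2.le, ?_⟩
    nlinarith
  | succ n ih =>
    obtain ⟨⟨a, b⟩, c, d⟩ := ih
    have hp : goldenRatio ^ (n + 2) = goldenRatio ^ (n + 1) + goldenRatio ^ n := by
      rw [pow_add, hsq, pow_succ]; ring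
    have hf : (Nat.fib (n + 1 + 3) : ℝ) = Nat.fib (n + 3) + Nat.fib (n + 2) := by
      rw [show n + 1 + 3 = n + 2 + 2 from rfl, Nat.fib_add_two]
      push_cast; ring
    refine ⟨⟨c, d⟩, ?_, ?_⟩
    · rw [show n + 1 + 1 = n + 2 from rfl, hp, hf]; linarith
    · rw [show n + 1 + 1 = n + 2 from rfl, hp, hf]; linarith

end Growth

/-! ### Nondegeneracy forced by birationality. -/

section Birational

open MvPolynomial

theorem exists_ne_zero_add_smul {V : MvPolynomial (Fin 2) ℂ} (hV : V ≠ 0) {d : Fin 2 → ℂ} :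
    ∃ (p : Fin 2 → ℂ) (t : ℂ), t ≠ 0 ∧ eval p V ≠ 0 ∧ eval (p + t • d) V ≠ 0 := by
  obtain ⟨p, hp⟩ : ∃ p, eval p V ≠ 0 := by
    by_contra! h
    exact hV (MvPolynomial.funext fun x => by rw [h x, map_zero])
  have hc : Continuous fun t : ℂ => eval (p + t • d) V :=
    (MvPolynomial.continuous_eval V).comp (by fun_prop)
  have hev : ∀ᶠ t in 𝓝[≠] (0 : ℂ), eval (p + t • d) V ≠ 0 :=
    (hc.tendsto 0).mono_left nhdsWithin_le_nhds |>.eventually_ne (by simpa using hp)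
  obtain ⟨t, ht, ht0⟩ := (hev.and self_mem_nhdsWithin).exists
  exact ⟨p, t, ht0, hp, ht⟩

/-- A birational map is injective off a curve, so it cannot be constant along all lines of one
direction. -/
theorem PlaneFrac.IsBirational.not_val_invariant {f : PlaneFrac} (hf : f.IsBirational)
    {d : Fin 2 → ℂ} (hd : d ≠ 0)
    (h : ∀ (p : Fin 2 → ℂ) (t : ℂ), f.Dom p → f.Dom (p + t • d) → f.val (p + t • d) = f.val p) : False := by
  obtain ⟨g, V, hV, hg⟩ := hf
  obtain ⟨p, t, ht, hp, hp'⟩ := exists_ne_zero_add_smul hV (d := d)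
  obtain ⟨hD, -, e⟩ := (hg p hp).1
  obtain ⟨hD', -, e'⟩ := (hg _ hp').1
  rw [h p t hD hD', e] at e'
  exact smul_ne_zero ht hd (by simpa using e')

theorem eval_affineForm (c : Fin 3 → ℂ) (p : Fin 2 → ℂ) :
    eval p (affineForm c) = c 0 + c 1 * p 0 + c 2 * p 1 := by
  simp [affineForm]

theorem fracMap_dom_iff {α β γ : Fin 3 → ℂ} {p : Fin 2 → ℂ} :
    (fracMap α β γ).Dom p ↔ γ 0 + γ 1 * p 0 + γ 2 * p 1 ≠ 0 := by
  simp [PlaneFrac.Dom, fracMap, Fin.forall_fin_two, eval_affineForm]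

theorem fracMap_val (α β γ : Fin 3 → ℂ) (p : Fin 2 → ℂ) :
    (fracMap α β γ).val p = ![α 0 + α 1 * p 0 + α 2 * p 1,
      (β 0 + β 1 * p 0 + β 2 * p 1) / (γ 0 + γ 1 * p 0 + γ 2 * p 1)] := by
  funext i
  fin_cases i <;> simp [PlaneFrac.val, fracMap, eval_affineForm]

theorem fracMap_nondegenerate {α β γ : Fin 3 → ℂ} (hbir : (fracMap α β γ).IsBirational)
    (hβ2 : β 2 = 0) (hγ2 : γ 2 = 0) : α 2 ≠ 0 ∧ β 0 * γ 1 - β 1 * γ 0 ≠ 0 := by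
  have hα2 : α 2 ≠ 0 := by
    intro h
    refine PlaneFrac.IsBirational.not_val_invariant hbir (d := ![0, 1]) (by simp) fun p t _ _ => ?_
    simp [fracMap_val, h, hβ2, hγ2, Matrix.vecHead]
  refine ⟨hα2, fun h => ?_⟩
  -- The first coordinate is constant in this direction; with zero determinant the second is a
  -- constant function.
  refine PlaneFrac.IsBirational.not_val_invariant hbir (d := ![α 2, -α 1]) (by simp [hα2]) fun p t h1 h2 => ?_
  rw [fracMap_dom_iff] at h1 h2
  simp only [hγ2, zero_mul, add_zero] at h1 h2
  rw [fracMap_val, fracMap_val]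
  simp only [hβ2, hγ2, zero_mul, add_zero]
  congr 1
  · simp; ring
  · congr 1
    rw [div_eq_div_iff h2 h1]
    simp
    linear_combination -(t * α 2) * h

end Birational

/-! ### Powers of 2×2 matrices and periodic Möbius maps. -/

section TwoByTwo

open Matrix

/-- Cayley–Hamilton reduces every power to the span of `M` and `1`. -/
theorem Matrix.exists_pow_eq_fin_two {K : Type*} [CommRing K] (M : Matrix (Fin 2) (Fin 2) K)
    (k : ℕ) : ∃ e f : K, M ^ k = e • M + f • (1 : Matrix (Fin 2) (Fin 2) K) := by
  induction k with
  | zero => exact ⟨0, 1, by simp⟩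
  | succ k ih =>
    obtain ⟨e, f, h⟩ := ih
    refine ⟨e * M.trace + f, -(e * M.det), ?_⟩
    rw [pow_succ, h]
    ext i j
    fin_cases i <;> fin_cases j <;>
      simp [Matrix.mul_apply, Fin.sum_univ_two, Matrix.det_fin_two, Matrix.trace_fin_two] <;> ring

theorem Matrix.pow_scalar_of_apply_one_zero {K : Type*} [Field K]
    {M : Matrix (Fin 2) (Fin 2) K} (hM : M 1 0 ≠ 0) {k : ℕ} (h : (M ^ k) 1 0 = 0) :
    ∃ f : K, M ^ k = f • (1 : Matrix (Fin 2) (Fin 2) K) := by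
  obtain ⟨e, f, he⟩ := M.exists_pow_eq_fin_two k
  rw [he] at h
  have : e = 0 := by simpa [hM] using h
  exact ⟨f, by rw [he, this, zero_smul, zero_add]⟩

/-- The matrix of `z ↦ b / (c + z)`. -/
def moebiusMatrix (b c : ℂ) : Matrix (Fin 2) (Fin 2) ℂ := !![0, b; 1, c]

/-- A zero lower-left entry says that the iterate fixes `∞`. As `h` itself does not, the power of
the matrix must be scalar. -/
theorem moebius_iterate_eq_id_iff {b c : ℂ} (hb : b ≠ 0) (k : ℕ) :
    (moebius b c)^[k] = id ↔ (moebiusMatrix b c ^ k) 1 0 = 0 := by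
  classical
  have hdet : (moebiusMatrix b c).det ≠ 0 := by simp [moebiusMatrix, Matrix.det_fin_two, hb]
  set G : GL (Fin 2) ℂ := Matrix.GeneralLinearGroup.mkOfDetNeZero _ hdet with hG
  have hGv : (G : Matrix (Fin 2) (Fin 2) ℂ) = moebiusMatrix b c := rfl
  have hpow : ((G ^ k : GL (Fin 2) ℂ) : Matrix (Fin 2) (Fin 2) ℂ) = moebiusMatrix b c ^ k := by
    rw [Units.val_pow_eq_pow_val, hGv]
  have hact : moebius b c = fun z => G • z := by
    funext z
    cases z with
    | infty =>
      rw [OnePoint.smul_infty_eq_ite]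
      simp [hGv, moebiusMatrix, moebius]
    | coe z =>
      rw [OnePoint.smul_some_eq_ite]
      simp [hGv, moebiusMatrix, moebius, add_comm]
  have hiter : (moebius b c)^[k] = fun z => G ^ k • z := by
    rw [hact]; exact smul_iterate G k
  rw [hiter]
  constructor
  · intro h
    have := OnePoint.smul_infty_eq_self_iff.1 (congrFun h OnePoint.infty)
    rwa [hpow] at this
  · intro h
    obtain ⟨f, hf⟩ := Matrix.pow_scalar_of_apply_one_zero (by simp [moebiusMatrix]) h
    have hf0 : f ≠ 0 := by
      rintro rfl
      have := (G ^ k).det_ne_zero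
      rw [hpow, hf] at this
      simp at this
    funext z
    cases z with
    | infty =>
      rw [OnePoint.smul_infty_eq_ite]
      simp [hpow, hf]
    | coe z =>
      rw [OnePoint.smul_some_eq_ite]
      simp [hpow, hf, hf0]

end TwoByTwo

/-! ### Affine conjugacy to the normal form. -/

section Conjugacy

open MvPolynomial

/-- The matrix of the one-dimensional map `x ↦ α₀ + α₂ (β₀ + β₁ x) / (γ₀ + γ₁ x)`. -/
def returnMatrix (α β γ : Fin 3 → ℂ) : Matrix (Fin 2) (Fin 2) ℂ :=
  !![α 0 * γ 1 + α 2 * β 1, α 0 * γ 0 + α 2 * β 0; γ 1, γ 0]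

/-- Fixing `∞` is unaffected by an affine change of variable and by scaling the matrix. -/
theorem pow_apply_eq_zero_iff_of_intertwine {N H : Matrix (Fin 2) (Fin 2) ℂ} {k₀ e₀ s : ℂ}
    (hk : k₀ ≠ 0) (hs : s ≠ 0) (h : !![k₀, e₀; 0, 1] * N = s • (H * !![k₀, e₀; 0, 1])) (k : ℕ) :
    (N ^ k) 1 0 = 0 ↔ (H ^ k) 1 0 = 0 := by
  have hpow : !![k₀, e₀; 0, 1] * N ^ k = s ^ k • (H ^ k * !![k₀, e₀; 0, 1]) := by
    induction k with
    | zero => simp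
    | succ k ih =>
      rw [pow_succ, ← mul_assoc, ih, smul_mul_assoc, mul_assoc, h, mul_smul_comm, smul_smul,
        ← mul_assoc, ← pow_succ, ← pow_succ]
  have := congrFun (congrFun hpow 1) 0
  simp [Matrix.mul_apply, Fin.sum_univ_two] at this
  rw [this]
  simp [hk, hs]

theorem eval_eq_zero_of_forall_ne_zero {V W : MvPolynomial (Fin 2) ℂ} (hV : V ≠ 0)
    (h : ∀ p, eval p V ≠ 0 → eval p W = 0) (p : Fin 2 → ℂ) : eval p W = 0 := by
  have : V * W = 0 := MvPolynomial.funext fun x => by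
    rw [map_mul, map_zero, mul_eq_zero]
    exact or_iff_not_imp_left.2 (h x)
  rw [(mul_eq_zero.1 this).resolve_left hV, map_zero]

theorem affineEquiv_apply (ψ : (Fin 2 → ℂ) ≃ᵃ[ℂ] (Fin 2 → ℂ)) (p : Fin 2 → ℂ) (i : Fin 2) :
    ψ p i = ψ 0 i + ψ.linear (Pi.single 0 1) i * p 0 + ψ.linear (Pi.single 1 1) i * p 1 := by
  have h1 : ψ p = ψ.linear p + ψ 0 := by
    simpa using ψ.map_vadd 0 p
  have h2 : p = p 0 • Pi.single 0 1 + p 1 • Pi.single 1 1 := by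
    funext j; fin_cases j <;> simp
  have h3 : ψ.linear p = p 0 • ψ.linear (Pi.single 0 1) + p 1 • ψ.linear (Pi.single 1 1) := by
    conv_lhs => rw [h2]
    simp only [map_add, map_smul]
  rw [h1, h3]
  simp
  ring

/-- Comparing first coordinates forces the linear part of `ψ` to be diagonal. Its first coordinate
`k 0 * x + e 0` then conjugates the return map to `h`, as the second coordinates show. -/
theorem returnMatrix_intertwine {α β γ : Fin 3 → ℂ} (hγ1 : γ 1 ≠ 0)
    (hdet : β 0 * γ 1 - β 1 * γ 0 ≠ 0) (hβ2 : β 2 = 0) (hγ2 : γ 2 = 0) (hα1 : α 1 = 0)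
    {b c : ℂ} (hb : b ≠ 0)
    (h : (fracMap α β γ).AffinelyConjugate (fracMap ![0, 0, 1] ![b, 0, 0] ![c, 1, 0])) :
    ∃ k₀ e₀ s : ℂ, k₀ ≠ 0 ∧ s ≠ 0 ∧
      !![k₀, e₀; 0, 1] * returnMatrix α β γ = s • (moebiusMatrix b c * !![k₀, e₀; 0, 1]) := by
  obtain ⟨ψ, V, hV, h⟩ := h
  obtain ⟨e, he⟩ : ∃ e, e = ψ 0 := ⟨_, rfl⟩
  obtain ⟨k, hk⟩ : ∃ k, k = ψ.linear (Pi.single 0 1) := ⟨_, rfl⟩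
  obtain ⟨l, hl⟩ : ∃ l, l = ψ.linear (Pi.single 1 1) := ⟨_, rfl⟩
  have hψ : ∀ p i, ψ p i = e i + k i * p 0 + l i * p 1 := fun p i => by
    rw [he, hk, hl]; exact affineEquiv_apply ψ p i
  have hrel : ∀ p : Fin 2 → ℂ, eval p V ≠ 0 → γ 0 + γ 1 * p 0 ≠ 0 ∧
      c + (e 0 + k 0 * p 0 + l 0 * p 1) ≠ 0 ∧
      (∀ i, e i + k i * (α 0 + α 2 * p 1) + l i * ((β 0 + β 1 * p 0) / (γ 0 + γ 1 * p 0)) =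
        ![e 1 + k 1 * p 0 + l 1 * p 1, b / (c + (e 0 + k 0 * p 0 + l 0 * p 1))] i) := by
    intro p hp
    obtain ⟨h1, h2, h3⟩ := h p hp
    rw [fracMap_dom_iff] at h1 h2
    refine ⟨by simpa [hγ2] using h1, by simpa [hψ] using h2, fun i => ?_⟩
    have := congrFun h3 i
    rw [hψ, fracMap_val, fracMap_val] at this
    simpa [hψ, hα1, hβ2, hγ2] using this
  have id0 : ∀ x y : ℂ, (e 0 + k 0 * (α 0 + α 2 * y) - (e 1 + k 1 * x + l 1 * y)) *
      (γ 0 + γ 1 * x) + l 0 * (β 0 + β 1 * x) = 0 := by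
    intro x y
    have := eval_eq_zero_of_forall_ne_zero hV
      (W := (C (e 0) + C (k 0) * (C (α 0) + C (α 2) * X 1) -
        (C (e 1) + C (k 1) * X 0 + C (l 1) * X 1)) * (C (γ 0) + C (γ 1) * X 0) +
        C (l 0) * (C (β 0) + C (β 1) * X 0)) (fun p hp => ?_) ![x, y]
    · simpa using this
    · obtain ⟨h1, -, h2⟩ := hrel p hp
      have h2 : e 0 + k 0 * (α 0 + α 2 * p 1) +
        l 0 * ((β 0 + β 1 * p 0) / (γ 0 + γ 1 * p 0)) = e 1 + k 1 * p 0 + l 1 * p 1 := h2 0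
      have hw := div_mul_cancel₀ (β 0 + β 1 * p 0) h1
      simp only [map_add, map_sub, map_mul, eval_C, eval_X]
      linear_combination (γ 0 + γ 1 * p 0) * h2 - l 0 * hw
  -- At the pole `-γ 0 / γ 1` only the `l 0` term survives, and its cofactor is nonzero by `hdet`.
  have hl0 : l 0 = 0 := by
    have := id0 (-(γ 0 / γ 1)) 0
    have hz : γ 0 + γ 1 * (-(γ 0 / γ 1)) = 0 := by field_simp; ring
    rw [hz, mul_zero, zero_add, mul_eq_zero] at this
    refine this.resolve_right fun h => hdet ?_
    field_simp at h
    linear_combination h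
  have id0' : ∀ x y : ℂ, (e 0 + k 0 * (α 0 + α 2 * y) - (e 1 + k 1 * x + l 1 * y)) *
      (γ 0 + γ 1 * x) = 0 := fun x y => by
    have := id0 x y
    rwa [hl0, zero_mul, add_zero] at this
  set x₀ : ℂ := (1 - γ 0) / γ 1 with hx₀
  have hx0 : γ 0 + γ 1 * x₀ = 1 := by rw [hx₀]; field_simp; ring
  set x₁ : ℂ := (2 - γ 0) / γ 1 with hx₁
  have hx1 : γ 0 + γ 1 * x₁ = 2 := by rw [hx₁]; field_simp; ring
  have a0 := id0' x₀ 0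
  have a1 := id0' x₁ 0
  have a2 := id0' x₀ 1
  rw [hx0, mul_one] at a0 a2
  rw [hx1] at a1
  have hl1 : l 1 = k 0 * α 2 := by linear_combination a0 - a2
  have hk1 : k 1 = 0 := by
    have hne : x₁ - x₀ ≠ 0 := by
      have : γ 1 * (x₁ - x₀) = 1 := by linear_combination hx1 - hx0
      exact right_ne_zero_of_mul (this ▸ one_ne_zero)
    refine (mul_eq_zero.1 (?_ : k 1 * (x₁ - x₀) = 0)).resolve_right hne
    linear_combination a0 - a1 / 2
  have he1 : e 1 = e 0 + k 0 * α 0 := by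
    rw [hk1] at a0
    linear_combination -a0
  have hk0 : k 0 ≠ 0 := by
    intro h0
    have : ψ.linear (Pi.single 0 1) = 0 := by
      rw [← hk]; funext i; fin_cases i
      · exact h0
      · exact hk1
    have := ψ.linear.map_eq_zero_iff.1 this
    simpa using congrFun this 0
  have id1 : ∀ x : ℂ, ((e 0 + k 0 * α 0) * (γ 0 + γ 1 * x) + k 0 * α 2 * (β 0 + β 1 * x)) *
      (c + e 0 + k 0 * x) - b * (γ 0 + γ 1 * x) = 0 := by
    intro x
    have := eval_eq_zero_of_forall_ne_zero hV
      (W := (C (e 0 + k 0 * α 0) * (C (γ 0) + C (γ 1) * X 0) +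
        C (k 0 * α 2) * (C (β 0) + C (β 1) * X 0)) * (C (c + e 0) + C (k 0) * X 0) -
        C b * (C (γ 0) + C (γ 1) * X 0)) (fun p hp => ?_) ![x, 0]
    · simpa using this
    · obtain ⟨h1, h2, h3⟩ := hrel p hp
      have h3 : e 1 + k 1 * (α 0 + α 2 * p 1) +
        l 1 * ((β 0 + β 1 * p 0) / (γ 0 + γ 1 * p 0)) =
          b / (c + (e 0 + k 0 * p 0 + l 0 * p 1)) := h3 1
      rw [hl0, zero_mul, add_zero] at h2 h3
      rw [hk1, he1, hl1, zero_mul, add_zero, eq_div_iff h2] at h3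
      have hw := div_mul_cancel₀ (β 0 + β 1 * p 0) h1
      simp only [map_add, map_sub, map_mul, eval_C, eval_X]
      linear_combination (γ 0 + γ 1 * p 0) * h3 - k 0 * α 2 * (c + (e 0 + k 0 * p 0)) * hw
  -- Values at `0`, `1`, `-1` isolate the three coefficients of a quadratic in `x`.
  have b0 := id1 0
  have b1 := id1 1
  have b2 := id1 (-1)
  have c2 : k 0 * (k 0 * (α 0 * γ 1 + α 2 * β 1) + e 0 * γ 1) = 0 := by
    linear_combination b1 / 2 + b2 / 2 - b0
  have c2' := (mul_eq_zero.1 c2).resolve_left hk0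
  have c1 : (k 0 * (α 0 * γ 0 + α 2 * β 0) + e 0 * γ 0) * k 0 = b * γ 1 := by
    linear_combination b1 / 2 - b2 / 2 - (c + e 0) * c2'
  have c0 : (k 0 * (α 0 * γ 0 + α 2 * β 0) + e 0 * γ 0) * (c + e 0) = b * γ 0 := by
    linear_combination b0
  have d0 : γ 1 * b = k 0 * (k 0 * (α 0 * γ 0 + α 2 * β 0) + e 0 * γ 0) := by
    linear_combination -c1
  have d1 : γ 0 * k 0 = γ 1 * (c + e 0) := by
    refine mul_left_cancel₀ hb ?_
    linear_combination (c + e 0) * c1 - k 0 * c0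
  -- The scalar is dictated by the lower-left entries, `γ 1` and `k 0`.
  refine ⟨k 0, e 0, γ 1 / k 0, hk0, div_ne_zero hγ1 hk0, ?_⟩
  ext i j
  fin_cases i <;> fin_cases j <;>
    simp [returnMatrix, moebiusMatrix, Matrix.mul_apply, Fin.sum_univ_two]
  · exact c2'
  · field_simp
    linear_combination -d0
  · field_simp
  · field_simp
    linear_combination d1

theorem exists_affinelyConjugate {α β γ : Fin 3 → ℂ} (hγ1 : γ 1 ≠ 0) (hα2 : α 2 ≠ 0)
    (hdet : β 0 * γ 1 - β 1 * γ 0 ≠ 0) (hβ2 : β 2 = 0) (hγ2 : γ 2 = 0) (hα1 : α 1 = 0) :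
    ∃ b c : ℂ, b ≠ 0 ∧
      (fracMap α β γ).AffinelyConjugate (fracMap ![0, 0, 1] ![b, 0, 0] ![c, 1, 0]) := by
  -- This translation moves the image of `∞` under the return map to `0 = h(∞)`.
  set e : ℂ := -(α 0 + α 2 * β 1 / γ 1) with he
  refine ⟨α 2 * (β 0 * γ 1 - β 1 * γ 0) / γ 1 ^ 2, γ 0 / γ 1 - e,
    div_ne_zero (mul_ne_zero hα2 hdet) (pow_ne_zero 2 hγ1), ?_⟩
  let D : (Fin 2 → ℂ) ≃ₗ[ℂ] (Fin 2 → ℂ) :=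
    LinearEquiv.piCongrRight fun i => LinearEquiv.smulOfNeZero ℂ ℂ (![1, α 2] i)
      (by fin_cases i <;> simp [hα2])
  let ψ : (Fin 2 → ℂ) ≃ᵃ[ℂ] (Fin 2 → ℂ) :=
    D.toAffineEquiv.trans (AffineEquiv.constVAdd ℂ _ ![e, e + α 0])
  have hψ : ∀ p, ψ p = ![e + p 0, e + α 0 + α 2 * p 1] := fun p => by
    funext i; fin_cases i <;> simp [ψ, D]
  refine ⟨ψ, affineForm γ, ?_, ?_⟩
  · intro h
    have := congrArg (eval ![(1 - γ 0) / γ 1, 0]) h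
    rw [eval_affineForm] at this
    simp [mul_div_cancel₀ _ hγ1] at this
  · intro p hp
    rw [eval_affineForm] at hp
    obtain ⟨w, hw⟩ : ∃ w, w = γ 0 + γ 1 * p 0 := ⟨_, rfl⟩
    have hp' : w ≠ 0 := by simpa [hw, hγ2] using hp
    have hden : γ 0 / γ 1 - e + 1 * (e + p 0) + 0 * (e + α 0 + α 2 * p 1) = w / γ 1 := by
      rw [hw]; field_simp; ring
    refine ⟨fracMap_dom_iff.2 hp, fracMap_dom_iff.2 ?_, ?_⟩
    · rw [hψ]
      exact hden.trans_ne (div_ne_zero hp' hγ1)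
    · rw [fracMap_val, fracMap_val, hψ, hψ]
      funext i
      fin_cases i
      · simp [hα1]; ring
      · have hgoal : e + α 0 + α 2 * ((β 0 + β 1 * p 0) / w) =
            α 2 * (β 0 * γ 1 - β 1 * γ 0) / γ 1 ^ 2 / (w / γ 1) := by
          rw [he]
          field_simp
          rw [hw]
          ring
        rw [← hden, hw] at hgoal
        simpa [hβ2, hγ2] using hgoal

end Conjugacy

/-! ### The case `α 1 = 0`: degrees one and two. -/

section AlternatingReturn

open MvPolynomial

variable (α β γ : Fin 3 → ℂ)

/-- Coefficients of the numerator of the first coordinate of the `n`-th iterate of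
`fracMap α β γ`, when `α 1 = β 2 = γ 2 = 0`. -/
noncomputable def splitNum (n : ℕ) : MvPolynomial (Fin 3) ℂ :=
  C ((returnMatrix α β γ ^ (n / 2)) 0 0) * (if Even n then X 1 else linearForm α) +
    C ((returnMatrix α β γ ^ (n / 2)) 0 1) * X 0

/-- The denominator that belongs to `splitNum`. -/
noncomputable def splitDen (n : ℕ) : MvPolynomial (Fin 3) ℂ :=
  C ((returnMatrix α β γ ^ (n / 2)) 1 0) * (if Even n then X 1 else linearForm α) +
    C ((returnMatrix α β γ ^ (n / 2)) 1 1) * X 0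

/-- The `n`-th iterate of the extension of `fracMap α β γ`, when `α 1 = β 2 = γ 2 = 0`. -/
noncomputable def splitTriple (n : ℕ) : Fin 3 → MvPolynomial (Fin 3) ℂ :=
  ![splitDen α β γ n * splitDen α β γ (n + 1), splitNum α β γ n * splitDen α β γ (n + 1),
    C (α 2)⁻¹ * (splitNum α β γ (n + 1) - C (α 0) * splitDen α β γ (n + 1)) * splitDen α β γ n]

variable {α β γ}

theorem splitNum_add_two (n : ℕ) : splitNum α β γ (n + 2) =
    C (α 0 * γ 1 + α 2 * β 1) * splitNum α β γ n +
      C (α 0 * γ 0 + α 2 * β 0) * splitDen α β γ n := by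
  have h : (n + 2) / 2 = n / 2 + 1 := by omega
  simp only [splitNum, splitDen, h, pow_succ', Nat.even_add_one, not_not]
  generalize returnMatrix α β γ ^ (n / 2) = M
  generalize (if Even n then X 1 else linearForm α) = y
  simp only [returnMatrix, Matrix.mul_apply, Fin.sum_univ_two, C_add, C_mul]
  simp
  ring

theorem splitDen_add_two (n : ℕ) : splitDen α β γ (n + 2) =
    C (γ 1) * splitNum α β γ n + C (γ 0) * splitDen α β γ n := by
  have h : (n + 2) / 2 = n / 2 + 1 := by omega
  simp only [splitNum, splitDen, h, pow_succ', Nat.even_add_one, not_not]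
  generalize returnMatrix α β γ ^ (n / 2) = M
  generalize (if Even n then X 1 else linearForm α) = y
  simp only [returnMatrix, Matrix.mul_apply, Fin.sum_univ_two, C_add, C_mul]
  simp
  ring

theorem returnMatrix_det_ne_zero (hα2 : α 2 ≠ 0) (hdet : β 0 * γ 1 - β 1 * γ 0 ≠ 0) :
    (returnMatrix α β γ).det ≠ 0 := by
  have : (returnMatrix α β γ).det = -(α 2 * (β 0 * γ 1 - β 1 * γ 0)) := by
    simp [returnMatrix, Matrix.det_fin_two]; ring
  rw [this]
  exact neg_ne_zero.2 (mul_ne_zero hα2 hdet)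

theorem splitDen_eq_linearForm (hα1 : α 1 = 0) (n : ℕ) : splitDen α β γ n =
    linearForm (if Even n then
      ![(returnMatrix α β γ ^ (n / 2)) 1 1, (returnMatrix α β γ ^ (n / 2)) 1 0, 0]
    else ![(returnMatrix α β γ ^ (n / 2)) 1 1 + (returnMatrix α β γ ^ (n / 2)) 1 0 * α 0, 0,
      (returnMatrix α β γ ^ (n / 2)) 1 0 * α 2]) := by
  unfold splitDen
  split_ifs <;> simp [linearForm, hα1] <;> ring

theorem splitFrac_coprime (hα2 : α 2 ≠ 0) (hdet : β 0 * γ 1 - β 1 * γ 0 ≠ 0)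
    {g : MvPolynomial (Fin 3) ℂ} (hg : Prime g) (n : ℕ) (h1 : g ∣ splitNum α β γ n) :
    ¬ g ∣ splitDen α β γ n := by
  intro h2
  have hM : (returnMatrix α β γ ^ (n / 2)).det ≠ 0 := by
    rw [Matrix.det_pow]; exact pow_ne_zero _ (returnMatrix_det_ne_zero hα2 hdet)
  unfold splitNum at h1
  unfold splitDen at h2
  generalize returnMatrix α β γ ^ (n / 2) = M at *
  generalize hy : (if Even n then X 1 else linearForm α) = y at *
  rw [Matrix.det_fin_two] at hM
  have hX : g ∣ X 0 := by
    refine dvd_of_dvd_C_mul hM ?_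
    convert dvd_sub (h2.mul_left (C (M 0 0))) (h1.mul_left (C (M 1 0))) using 1
    simp only [C_sub, C_mul]; ring
  have hY : g ∣ y := by
    refine dvd_of_dvd_C_mul hM ?_
    convert dvd_sub (h1.mul_left (C (M 1 1))) (h2.mul_left (C (M 0 1))) using 1
    simp only [C_sub, C_mul]; ring
  rw [X_eq_linearForm] at hX
  have hne := linearForm_ne_zero (c := Pi.single 0 1) (x := ![1, 0, 0]) (by simp [eval_linearForm])
  rw [← hy] at hY
  split_ifs at hY
  · rw [X_eq_linearForm] at hY
    exact not_dvd_linearForm hg ![0, 1, 0] hne (by simp [eval_linearForm])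
      (by simp [eval_linearForm]) hX hY
  · exact not_dvd_linearForm hg ![0, 0, 1] hne (by simp [eval_linearForm])
      (by simp [eval_linearForm, hα2]) hX hY

theorem splitDen_ne_zero (hα1 : α 1 = 0) (hα2 : α 2 ≠ 0) (hdet : β 0 * γ 1 - β 1 * γ 0 ≠ 0)
    (n : ℕ) : splitDen α β γ n ≠ 0 := by
  have hM : (returnMatrix α β γ ^ (n / 2)).det ≠ 0 := by
    rw [Matrix.det_pow]; exact pow_ne_zero _ (returnMatrix_det_ne_zero hα2 hdet)
  rw [splitDen_eq_linearForm hα1]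
  generalize returnMatrix α β γ ^ (n / 2) = M at *
  rw [Matrix.det_fin_two] at hM
  by_cases h : M 1 0 = 0
  · have h' : M 1 1 ≠ 0 := fun h' => hM (by rw [h, h']; ring)
    exact linearForm_ne_zero (x := ![1, 0, 0]) (by
      split_ifs <;> simp [eval_linearForm, h, h'])
  · exact linearForm_ne_zero (x := ![0, 1, 1]) (by
      split_ifs <;> simp [eval_linearForm, h, hα2])

theorem projEq_splitTriple (hα1 : α 1 = 0) (hα2 : α 2 ≠ 0) (hdet : β 0 * γ 1 - β 1 * γ 0 ≠ 0)
    (hβ2 : β 2 = 0) (hγ2 : γ 2 = 0) (n : ℕ) :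
    ProjEq (iterTriple (projMap α β γ) n) (splitTriple α β γ n) := by
  have hC : C (α 2) * C (α 2)⁻¹ = (1 : MvPolynomial (Fin 3) ℂ) := by
    rw [← C_mul, mul_inv_cancel₀ hα2, C_1]
  induction n with
  | zero =>
    refine ⟨X 0, 1, X_ne_zero 0, one_ne_zero, fun i => ?_⟩
    fin_cases i <;> simp [iterTriple, splitTriple, splitNum, splitDen, linearForm, hα1]
    · ring
    · linear_combination -(X 0 * X 2) * hC
  | succ n ih =>
    refine ih.iterTriple_succ ⟨1, splitDen α β γ n * splitDen α β γ (n + 1), one_ne_zero,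
      mul_ne_zero (splitDen_ne_zero hα1 hα2 hdet n) (splitDen_ne_zero hα1 hα2 hdet (n + 1)),
      fun i => ?_⟩
    unfold splitTriple
    rw [splitNum_add_two, splitDen_add_two]
    generalize splitNum α β γ n = r
    generalize splitDen α β γ n = s
    generalize splitNum α β γ (n + 1) = r'
    generalize splitDen α β γ (n + 1) = s'
    fin_cases i <;> simp [hα1, hβ2, hγ2, -mul_eq_mul_left_iff, -mul_eq_mul_right_iff]
    · ring
    · linear_combination s' * (C (γ 0) * s + C (γ 1) * r) * (r' - C (α 0) * s') * s * hC
    · linear_combination -(s * s' * s' * (C (β 0) * s + C (β 1) * r)) * hC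

theorem isHomogeneous_split (n : ℕ) :
    (splitNum α β γ n).IsHomogeneous 1 ∧ (splitDen α β γ n).IsHomogeneous 1 := by
  have h : (if Even n then X 1 else linearForm α).IsHomogeneous 1 := by
    split_ifs
    · exact isHomogeneous_X ℂ _
    · exact isHomogeneous_linearForm _
  exact ⟨(isHomogeneous_C_mul h _).add (isHomogeneous_C_mul (isHomogeneous_X ℂ _) _),
    (isHomogeneous_C_mul h _).add (isHomogeneous_C_mul (isHomogeneous_X ℂ _) _)⟩

/-- One denominator involves only `X 0, X 1` and the other only `X 0, X 2`, so a common prime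
requires both to be multiples of `X 0`. For odd `n` this would make the lower-left entries of two
consecutive matrix powers vanish, which `γ 1 ≠ 0` prevents. -/
theorem splitDen_coprime (hα1 : α 1 = 0) (hα2 : α 2 ≠ 0) (hγ1 : γ 1 ≠ 0)
    (hdet : β 0 * γ 1 - β 1 * γ 0 ≠ 0) {n : ℕ}
    (hn : ¬ (Even n ∧ (returnMatrix α β γ ^ (n / 2)) 1 0 = 0))
    {g : MvPolynomial (Fin 3) ℂ} (hg : Prime g) (h : g ∣ splitDen α β γ n) :
    ¬ g ∣ splitDen α β γ (n + 1) := by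
  intro h'
  have k := splitDen_ne_zero hα1 hα2 hdet n
  have k' := splitDen_ne_zero hα1 hα2 hdet (n + 1)
  rw [splitDen_eq_linearForm hα1] at h h' k k'
  rcases Nat.even_or_odd n with he | ho
  · have hM : (returnMatrix α β γ ^ (n / 2)) 1 0 ≠ 0 := fun h => hn ⟨he, h⟩
    have hodd : ¬ Even (n + 1) := by simpa [Nat.even_add_one] using he
    have hdiv : (n + 1) / 2 = n / 2 := by rcases he with ⟨m, rfl⟩; omega
    rw [if_neg hodd, hdiv] at h' k'
    rw [if_pos he] at h k
    exact not_dvd_linearForm hg ![0, 0, 1] k (by simp [eval_linearForm])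
      (by simp [eval_linearForm, hα2, hM]) h h'
  · have hne : ¬ Even n := Nat.not_even_iff_odd.2 ho
    have heven : Even (n + 1) := ho.add_one
    have hdiv : (n + 1) / 2 = n / 2 + 1 := by rcases ho with ⟨m, rfl⟩; omega
    rw [if_pos heven, hdiv] at h' k'
    rw [if_neg hne] at h k
    by_cases h1 : (returnMatrix α β γ ^ (n / 2 + 1)) 1 0 = 0
    · have h0 : (returnMatrix α β γ ^ (n / 2)) 1 0 ≠ 0 := by
        intro h0
        have hM : (returnMatrix α β γ ^ (n / 2)).det ≠ 0 := by
          rw [Matrix.det_pow]; exact pow_ne_zero _ (returnMatrix_det_ne_zero hα2 hdet)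
        rw [Matrix.det_fin_two, h0, mul_zero, sub_zero] at hM
        rw [pow_succ, Matrix.mul_apply, Fin.sum_univ_two, h0, zero_mul, zero_add] at h1
        exact mul_ne_zero (right_ne_zero_of_mul hM) (by simpa [returnMatrix] using hγ1) h1
      exact not_dvd_linearForm hg ![0, 0, 1] k' (by simp [eval_linearForm])
        (by simp [eval_linearForm, hα2, h0]) h' h
    · exact not_dvd_linearForm hg ![0, 1, 0] k (by simp [eval_linearForm])
        (by simp [eval_linearForm, h1]) h h'

theorem iterDegree_eq_two (hα1 : α 1 = 0) (hα2 : α 2 ≠ 0) (hγ1 : γ 1 ≠ 0)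
    (hdet : β 0 * γ 1 - β 1 * γ 0 ≠ 0) (hβ2 : β 2 = 0) (hγ2 : γ 2 = 0) {n : ℕ}
    (hn : ¬ (Even n ∧ (returnMatrix α β γ ^ (n / 2)) 1 0 = 0)) : iterDegree α β γ n = 2 := by
  refine mapDegree_eq_of_projEq (projEq_splitTriple hα1 hα2 hdet hβ2 hγ2 n) ?_ ?_
  · intro g hg
    by_contra! h
    have h0 : g ∣ splitDen α β γ n * splitDen α β γ (n + 1) := h 0
    have h1 : g ∣ splitNum α β γ n * splitDen α β γ (n + 1) := h 1
    have h2 : g ∣ C (α 2)⁻¹ * (splitNum α β γ (n + 1) - C (α 0) * splitDen α β γ (n + 1)) *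
      splitDen α β γ n := h 2
    by_cases hd : g ∣ splitDen α β γ n
    · have hd' := splitDen_coprime hα1 hα2 hγ1 hdet hn hg hd
      exact splitFrac_coprime hα2 hdet hg n ((hg.dvd_or_dvd h1).resolve_right hd') hd
    · have hd' := (hg.dvd_or_dvd h0).resolve_left hd
      have h3 := dvd_of_dvd_C_mul (inv_ne_zero hα2) ((hg.dvd_or_dvd h2).resolve_right hd)
      exact splitFrac_coprime hα2 hdet hg (n + 1)
        ((dvd_sub_left (hd'.mul_left _)).1 h3) hd'
  · have hh := fun n => isHomogeneous_split (α := α) (β := β) (γ := γ) n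
    intro i
    fin_cases i
    · exact (hh n).2.mul (hh (n + 1)).2
    · exact (hh n).1.mul (hh (n + 1)).2
    · exact (isHomogeneous_C_mul
        ((hh (n + 1)).1.sub (isHomogeneous_C_mul (hh (n + 1)).2 _)) _).mul (hh n).2

theorem iterDegree_eq_one (hα1 : α 1 = 0) (hα2 : α 2 ≠ 0) (hγ1 : γ 1 ≠ 0)
    (hdet : β 0 * γ 1 - β 1 * γ 0 ≠ 0) (hβ2 : β 2 = 0) (hγ2 : γ 2 = 0) {k : ℕ}
    (hk : (returnMatrix α β γ ^ k) 1 0 = 0) : iterDegree α β γ (2 * k) = 1 := by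
  obtain ⟨f, hf⟩ := Matrix.pow_scalar_of_apply_one_zero (by simpa [returnMatrix] using hγ1) hk
  have hf0 : f ≠ 0 := by
    rintro rfl
    have := pow_ne_zero k (returnMatrix_det_ne_zero hα2 hdet)
    rw [← Matrix.det_pow, hf] at this
    simp at this
  -- For a scalar power `f • 1`, the quadratic triple is `f² * X 0` times the coordinates.
  refine mapDegree_eq_of_projEq ((projEq_splitTriple hα1 hα2 hdet hβ2 hγ2 (2 * k)).trans
    ⟨1, C f * C f * X 0, one_ne_zero, ?_, fun i => ?_⟩) noCommonPrime_X
    fun i => isHomogeneous_X ℂ i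
  · simp [hf0, X_ne_zero]
  · have hC : C (α 2) * C (α 2)⁻¹ = (1 : MvPolynomial (Fin 3) ℂ) := by
      rw [← C_mul, mul_inv_cancel₀ hα2, C_1]
    have h1 : (2 * k) / 2 = k := by omega
    have h2 : (2 * k + 1) / 2 = k := by omega
    fin_cases i <;>
      simp [splitTriple, splitNum, splitDen, h1, h2, hf, linearForm, hα1]
    · ring
    · ring
    · linear_combination (C f * C f * X 0 * X 2) * hC

theorem hasDynamicalDegree_one (hα1 : α 1 = 0) (hα2 : α 2 ≠ 0) (hγ1 : γ 1 ≠ 0)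
    (hdet : β 0 * γ 1 - β 1 * γ 0 ≠ 0) (hβ2 : β 2 = 0) (hγ2 : γ 2 = 0) :
    HasDynamicalDegree α β γ 1 := by
  have h : ∀ n, iterDegree α β γ n = 1 ∨ iterDegree α β γ n = 2 := by
    intro n
    by_cases hn : Even n ∧ (returnMatrix α β γ ^ (n / 2)) 1 0 = 0
    · left
      have := iterDegree_eq_one hα1 hα2 hγ1 hdet hβ2 hγ2 hn.2
      rwa [Nat.two_mul_div_two_of_even hn.1] at this
    · exact Or.inr (iterDegree_eq_two hα1 hα2 hγ1 hdet hβ2 hγ2 hn)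
  refine tendsto_rpow_one_div_of_bounds one_pos two_pos (fun n => ?_) fun n => ?_
  · rcases h n with h | h <;> rw [h] <;> norm_num
  · rcases h n with h | h <;> rw [h] <;> norm_num

theorem IsPeriodicMap.iterate_eq_id_iff {S : Type*} {h : S → S} {k : ℕ}
    (hk : IsPeriodicMap h k) (m : ℕ) : h^[m] = id ↔ k ∣ m := by
  obtain ⟨⟨hk0, hkid⟩, hmin⟩ := hk
  constructor
  · intro hm
    rw [Nat.dvd_iff_mod_eq_zero]
    by_contra hne
    have hlt := Nat.mod_lt m hk0
    have : h^[m % k] = id := by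
      rw [← Nat.mod_add_div m k, Function.iterate_add, Function.iterate_mul, hkid,
        Function.iterate_id, Function.comp_id] at hm
      exact hm
    exact absurd (hmin ⟨Nat.pos_of_ne_zero hne, this⟩) (not_le.2 hlt)
  · rintro ⟨j, rfl⟩
    rw [Function.iterate_mul, hkid, Function.iterate_id]

end AlternatingReturn

theorem theorem4p7 (α β γ : Fin 3 → ℂ)
    (hγ : (γ 1, γ 2) ≠ (0, 0))
    (hbir : (fracMap α β γ).IsBirational)
    (hβγ : β 1 * γ 2 - β 2 * γ 1 = 0)
    (hγ2 : γ 2 = 0) :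
    (α 1 ≠ 0 →
      (∀ n : ℕ, iterDegree α β γ (n + 2) = iterDegree α β γ (n + 1) + iterDegree α β γ n) ∧
      HasDynamicalDegree α β γ ((1 + √5) / 2)) ∧
    (α 1 = 0 →
      (∃ b c : ℂ, b ≠ 0 ∧
        (fracMap α β γ).AffinelyConjugate (fracMap ![0, 0, 1] ![b, 0, 0] ![c, 1, 0])) ∧
      HasDynamicalDegree α β γ 1 ∧
      ∀ b c : ℂ, b ≠ 0 →
        (fracMap α β γ).AffinelyConjugate (fracMap ![0, 0, 1] ![b, 0, 0] ![c, 1, 0]) →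
        ((¬ ∃ k : ℕ, IsPeriodicMap (moebius b c) k) →
          ∀ n : ℕ, 1 ≤ n → iterDegree α β γ n = 2) ∧
        (∀ k : ℕ, IsPeriodicMap (moebius b c) k →
          (∀ n : ℕ, iterDegree α β γ (n + 2 * k) = iterDegree α β γ n) ∧
          ∀ m : ℕ, 0 < m →
            (∀ n : ℕ, 1 ≤ n → iterDegree α β γ (n + m) = iterDegree α β γ n) →
            2 * k ≤ m)) := by
  have hγ1 : γ 1 ≠ 0 := fun h => hγ (by rw [h, hγ2])
  have hβ2 : β 2 = 0 := by
    rw [hγ2, mul_zero, zero_sub, neg_eq_zero] at hβγ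
    exact (mul_eq_zero.1 hβγ).resolve_right hγ1
  obtain ⟨hα2, hdet⟩ := fracMap_nondegenerate hbir hβ2 hγ2
  refine ⟨fun hα1 => ?_, fun hα1 => ⟨exists_affinelyConjugate hγ1 hα2 hdet hβ2 hγ2 hα1,
    hasDynamicalDegree_one hα1 hα2 hγ1 hdet hβ2 hγ2, fun b c hb hconj => ?_⟩⟩
  · have hd := iterDegree_eq_fib (α := α) hα1 hα2 hγ1 hdet hβ2 hγ2
    refine ⟨fun n => ?_, ?_⟩
    · rw [hd, hd, hd]
      exact Nat.fib_add_two.trans (add_comm _ _)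
    · refine tendsto_rpow_one_div_of_bounds Real.goldenRatio_pos Real.goldenRatio_pos
        (fun n => ?_) fun n => ?_
      · rw [hd]; exact (goldenRatio_pow_le_fib n).1.1
      · rw [hd]; exact (goldenRatio_pow_le_fib n).1.2
  · obtain ⟨k₀, e₀, s, hk₀, hs, hint⟩ :=
      returnMatrix_intertwine hγ1 hdet hβ2 hγ2 hα1 hb hconj
    have hid : ∀ j, (returnMatrix α β γ ^ j) 1 0 = 0 ↔ (moebius b c)^[j] = id := fun j => by
      rw [moebius_iterate_eq_id_iff hb, pow_apply_eq_zero_iff_of_intertwine hk₀ hs hint]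
    have htwo : ∀ n, ¬ (Even n ∧ (moebius b c)^[n / 2] = id) → iterDegree α β γ n = 2 :=
      fun n hn => iterDegree_eq_two hα1 hα2 hγ1 hdet hβ2 hγ2 (by rwa [hid])
    have hone : ∀ j, (moebius b c)^[j] = id → iterDegree α β γ (2 * j) = 1 :=
      fun j hj => iterDegree_eq_one hα1 hα2 hγ1 hdet hβ2 hγ2 ((hid j).2 hj)
    refine ⟨fun hper n hn => htwo n ?_, fun k hk => ?_⟩
    · rintro ⟨he, hi⟩
      refine hper ⟨_, isLeast_csInf ⟨n / 2, ?_, hi⟩⟩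
      rcases he with ⟨m, rfl⟩
      omega
    · have hval : ∀ n, iterDegree α β γ n = if 2 * k ∣ n then 1 else 2 := by
        intro n
        split_ifs with h
        · obtain ⟨j, rfl⟩ := h
          rw [mul_assoc]
          exact hone _ ((hk.iterate_eq_id_iff _).2 (dvd_mul_right k j))
        · refine htwo n ?_
          rintro ⟨he, hi⟩
          rw [hk.iterate_eq_id_iff] at hi
          refine h ?_
          rw [← Nat.two_mul_div_two_of_even he]
          exact mul_dvd_mul_left 2 hi
      have hk0 : 0 < k := hk.1.1
      refine ⟨fun n => ?_, fun m hm h => ?_⟩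
      · simp only [hval, Nat.dvd_add_self_right]
      · have := h (2 * k) (by omega)
        rw [hval, hval, if_pos dvd_rfl] at this
        refine Nat.le_of_dvd hm ?_
        by_contra hnot
        rw [if_neg fun h => hnot ((Nat.dvd_add_right dvd_rfl).1 h)] at this
        omega
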